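/- **Proposition (uniform modulus of continuity for $U_{z,w}$).** Let $\mathbb{S}=\{z\in\mathbb{C}:0<\operatorname{Re}z<1\}$. *Sequence structures.* A sequence structure on a complex Banach space $X$ is a Banach space $\mathfrak{S}$ of sequences $\vec x=(x_k)_{k\in\mathbb{Z}}$ in $X$ that is isometrically translation invariant and satisfies $\ell^1(\mathbb{Z};X)\subset\mathfrak{S}\subset\ell^\infty(\mathbb{Z};X)$ with contractive inclusions. It is reflection invariant if $\|(x_{-k})_k\|_{\mathfrak{S}}=\|(x_k)_k\|_{\mathfrak{S}}$, and $c_0$ if the Cesàro operators $C_n\vec x=\frac1{n+1}\sum_{m=0}^n(\dots,0,x_{-m},\dots,x_m,0,\dots)$ satisfy $\|C_n\vec x\|_{\mathfrak{S}}\le\|\vec x\|_{\mathfrak{S}}$ and $C_n\vec x\to\vec x$ for all $\vec x\in\mathfrak{S}$. For $a\in\mathbb{C}\setminus\{0\}$ put $\|\vec x\|_{\mathfrak{S}(a)}=\|(a^kx_k)_k\|_{\mathfrak{S}}$. *Daher couples.* Let $(X_0,X_1)$ be a compatible couple of complex Banach spaces (both continuously embedded in a Hausdorff topological vector space) with sequence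 structures $\mathfrak{S}_0,\mathfrak{S}_1$ on $X_0,X_1$, and write $\mathcal{X}_j=[X_j,\mathfrak{S}_j]$. The couple $(\mathcal{X}_0,\mathcal{X}_1)$ is a Daher couple if $X_0\cap X_1$ is dense in $X_0$ and in $X_1$, and $\mathfrak{S}_0,\mathfrak{S}_1$ are uniformly convex, reflection invariant and $c_0$. *Interpolation spaces.* For $z\in\mathbb{S}$ and a sequence $\vec x$ in $X_0\cap X_1$ put $N_z(\vec x)=\big(\|\vec x\|_{\mathfrak{S}_0(e^{-z})}^2+\|\vec x\|_{\mathfrak{S}_1(e^{1-z})}^2\big)^{1/2}$. For $x\in X_0+X_1$ let $\|x\|_{z,2}=\inf\{N_z(\vec x):\sum_{k\in\mathbb{Z}}x_k=x\text{ in }X_0+X_1\}$, and let $\mathcal{X}_z^{(2)}=\{x\in X_0+X_1:\|x\|_{z,2}<\infty\}$, with unit sphere $S_{\mathcal{X}_z^{(2)}}$. Let $\mathcal{H}^2_\pi$ be the space of analytic, $2\pi i$-periodic functions $f:\mathbb{S}\to X_0+X_1$ with $\|f\|_{\mathcal{H}^2_\pi}=N_{z_0}(\hat f_{z_0})<\infty$,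 where $\hat f_{z_0}(k)=\frac1{2\pi}\int_0^{2\pi}f(z_0+it)e^{-ikt}\,dt$ and $z_0=\tfrac12$ (the norm does not depend on the choice of $z_0\in\mathbb{S}$). *Statement.* Let $(\mathcal{X}_0,\mathcal{X}_1)$ be a Daher couple. For all $z\in\mathbb{S}$ and $x\in S_{\mathcal{X}_z^{(2)}}$ there is a unique $f\in\mathcal{H}^2_\pi$ with $f(z)=x$ and $\|f\|_{\mathcal{H}^2_\pi}=\|x\|_{z,2}=1$; denote it by $\Gamma_z(x)$. For all $z,w\in\mathbb{S}$ the formula $U_{z,w}(x)=\Gamma_z(x)(w)$ defines a map $U_{z,w}:S_{\mathcal{X}_z^{(2)}}\to\mathcal{X}_w^{(2)}$. There is one function $\gamma:[0,\infty)\to[0,\infty)$ with $\gamma(\epsilon)\to0$ as $\epsilon\to0$ such that, for all $z,w\in\mathbb{S}$ and all $\epsilon\ge0$, $$\sup\{\|U_{z,w}(x)-U_{z,w}(y)\|_{w,2}: x,y\in S_{\mathcal{X}_z^{(2)}},\ \|x-y\|_{z,2}\le\epsilon\}\le\gamma(\epsilon).$$ -/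

import Mathlib

open Set Filter Topology
open scoped ENNReal NNReal

noncomputable section

/-- The open strip `{z : 0 < Re z < 1}`. -/
def unitStrip : Set ℂ := {z | 0 < z.re ∧ z.re < 1}

/-- A sequence structure on the complex Banach space `X`: a Banach space of `X`-valued
sequences indexed by `ℤ`, isometrically translation invariant, with contractive inclusions
`ℓ¹(ℤ; X) ⊆ 𝔖 ⊆ ℓ^∞(ℤ; X)` (for `X ≠ 0` their norms are then equal to one).  The Banach space is
the type `E`; the linear injection `toSeq` says which sequence an element of `E` is. -/
structure SequenceStructure (X E : Type*) [NormedAddCommGroup X] [NormedSpace ℂ X]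
    [NormedAddCommGroup E] [NormedSpace ℂ E] where
  toSeq : E →ₗ[ℂ] (ℤ → X)
  toSeq_injective : Function.Injective toSeq
  translate : ∀ (e : E) (n : ℤ), ∃ e' : E, (∀ k, toSeq e' k = toSeq e (k + n)) ∧ ‖e'‖ = ‖e‖
  of_summable : ∀ x : ℤ → X, Summable (fun k => ‖x k‖) →
    ∃ e : E, toSeq e = x ∧ ‖e‖ ≤ ∑' k, ‖x k‖
  norm_apply_le : ∀ (e : E) (k : ℤ), ‖toSeq e k‖ ≤ ‖e‖

namespace SequenceStructure

variable {X E : Type*} [NormedAddCommGroup X] [NormedSpace ℂ X]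
  [NormedAddCommGroup E] [NormedSpace ℂ E]

/-- The norm of the sequence `x` in `𝔖`, equal to `∞` exactly when `x` is not in `𝔖`. -/
def seqNorm (S : SequenceStructure X E) (x : ℤ → X) : ℝ≥0∞ :=
  ⨅ (e : E) (_ : S.toSeq e = x), ‖e‖ₑ

/-- `𝔖` is invariant under the reflection `(x_k) ↦ (x_{-k})`, isometrically. -/
def ReflectionInvariant (S : SequenceStructure X E) : Prop :=
  ∀ x : ℤ → X, S.seqNorm (fun k => x (-k)) = S.seqNorm x

/-- The Cesàro operator `C_n x = (n+1)⁻¹ ∑_{m=0}^n (…, 0, x_{-m}, …, x_m, 0, …)`. -/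
def cesaro (n : ℕ) (x : ℤ → X) : ℤ → X :=
  fun k => ((n : ℂ) + 1)⁻¹ • ∑ m ∈ Finset.range (n + 1), if |k| ≤ (m : ℤ) then x k else 0

/-- The `c₀` property: the Cesàro operators are contractions of `𝔖` and converge strongly to
the identity. -/
structure IsCZero (S : SequenceStructure X E) : Prop where
  seqNorm_cesaro_le : ∀ (n : ℕ) (x : ℤ → X), S.seqNorm (cesaro n x) ≤ S.seqNorm x
  tendsto_cesaro : ∀ x : ℤ → X, S.seqNorm x < ⊤ →
    Tendsto (fun n => S.seqNorm (cesaro n x - x)) atTop (𝓝 0)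

/-- The norm in the weighted space `𝔖(a)`, `‖x‖_{𝔖(a)} = ‖(a^k x_k)_k‖_𝔖`, of a sequence in a
space `W` that contains `X` through the injection `ι`; it is `∞` when `x` is not a sequence of
elements of `X` that belongs to `𝔖(a)`. -/
def weightedNorm {W : Type*} [AddCommGroup W] [Module ℂ W] (S : SequenceStructure X E)
    (ι : X →ₗ[ℂ] W) (a : ℂ) (x : ℤ → W) : ℝ≥0∞ :=
  ⨅ (u : ℤ → X) (_ : ∀ k, ι (u k) = x k), S.seqNorm (fun k => a ^ k • u k)

end SequenceStructure

/-- A compatible couple of sequentially structured Banach spaces: Banach spaces `X₀`, `X₁`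
continuously embedded in a Hausdorff topological vector space `V`, with sequence structures on
them. -/
structure SequentialCouple (X₀ X₁ V E₀ E₁ : Type*)
    [NormedAddCommGroup X₀] [NormedSpace ℂ X₀] [NormedAddCommGroup X₁] [NormedSpace ℂ X₁]
    [AddCommGroup V] [Module ℂ V] [TopologicalSpace V]
    [NormedAddCommGroup E₀] [NormedSpace ℂ E₀] [NormedAddCommGroup E₁] [NormedSpace ℂ E₁] where
  j₀ : X₀ →L[ℂ] V
  j₁ : X₁ →L[ℂ] V
  j₀_injective : Function.Injective j₀
  j₁_injective : Function.Injective j₁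
  S₀ : SequenceStructure X₀ E₀
  S₁ : SequenceStructure X₁ E₁

namespace SequentialCouple

variable {X₀ X₁ V E₀ E₁ : Type*}
  [NormedAddCommGroup X₀] [NormedSpace ℂ X₀] [NormedAddCommGroup X₁] [NormedSpace ℂ X₁]
  [AddCommGroup V] [Module ℂ V] [TopologicalSpace V] [IsTopologicalAddGroup V]
  [ContinuousSMul ℂ V] [T2Space V]
  [NormedAddCommGroup E₀] [NormedSpace ℂ E₀] [NormedAddCommGroup E₁] [NormedSpace ℂ E₁]

/-- The map `(x₀, x₁) ↦ x₀ + x₁` from the `ℓ¹`-direct sum of `X₀` and `X₁` to `V`. -/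
def addMap (C : SequentialCouple X₀ X₁ V E₀ E₁) : WithLp 1 (X₀ × X₁) →L[ℂ] V :=
  C.j₀.comp (WithLp.fstL 1 ℂ X₀ X₁) + C.j₁.comp (WithLp.sndL 1 ℂ X₀ X₁)

/-- The kernel of `addMap`. -/
def addKer (C : SequentialCouple X₀ X₁ V E₀ E₁) : Submodule ℂ (WithLp 1 (X₀ × X₁)) :=
  LinearMap.ker C.addMap.toLinearMap

instance (C : SequentialCouple X₀ X₁ V E₀ E₁) :
    IsClosed (C.addKer : Set (WithLp 1 (X₀ × X₁))) :=
  ContinuousLinearMap.isClosed_ker C.addMap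

/-- The sum `X₀ + X₁ ⊆ V` with its norm `inf {‖x₀‖ + ‖x₁‖ : x = x₀ + x₁}`, realized as the
quotient of the `ℓ¹`-direct sum by the kernel of `(x₀, x₁) ↦ x₀ + x₁ ∈ V`. -/
abbrev Sum (C : SequentialCouple X₀ X₁ V E₀ E₁) : Type _ := WithLp 1 (X₀ × X₁) ⧸ C.addKer

/-- The inclusion `X₀ ⊆ X₀ + X₁`. -/
def ι₀ (C : SequentialCouple X₀ X₁ V E₀ E₁) : X₀ →ₗ[ℂ] C.Sum where
  toFun x := Submodule.Quotient.mk (WithLp.toLp 1 (x, 0))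
  map_add' x y := by
    rw [← Submodule.Quotient.mk_add, ← WithLp.toLp_add, Prod.mk_add_mk, add_zero]
  map_smul' c x := by
    rw [RingHom.id_apply, ← Submodule.Quotient.mk_smul, ← WithLp.toLp_smul, Prod.smul_mk,
      smul_zero]

/-- The inclusion `X₁ ⊆ X₀ + X₁`. -/
def ι₁ (C : SequentialCouple X₀ X₁ V E₀ E₁) : X₁ →ₗ[ℂ] C.Sum where
  toFun x := Submodule.Quotient.mk (WithLp.toLp 1 (0, x))
  map_add' x y := by
    rw [← Submodule.Quotient.mk_add, ← WithLp.toLp_add, Prod.mk_add_mk, add_zero]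
  map_smul' c x := by
    rw [RingHom.id_apply, ← Submodule.Quotient.mk_smul, ← WithLp.toLp_smul, Prod.smul_mk,
      smul_zero]

/-- The couple is regular: `X₀ ∩ X₁` is dense in `X₀` and in `X₁`. -/
def IsRegular (C : SequentialCouple X₀ X₁ V E₀ E₁) : Prop :=
  Dense {x : X₀ | ∃ y : X₁, C.j₁ y = C.j₀ x} ∧ Dense {y : X₁ | ∃ x : X₀, C.j₀ x = C.j₁ y}

/-- A Daher couple: a regular couple of uniformly convex reflection invariant
`c₀`-sequentially structured Banach spaces. -/
structure IsDaher (C : SequentialCouple X₀ X₁ V E₀ E₁) : Prop where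
  regular : C.IsRegular
  uniformConvex₀ : UniformConvexSpace E₀
  uniformConvex₁ : UniformConvexSpace E₁
  reflection₀ : C.S₀.ReflectionInvariant
  reflection₁ : C.S₁.ReflectionInvariant
  cZero₀ : C.S₀.IsCZero
  cZero₁ : C.S₁.IsCZero

/-- The norm of `𝔖₀(e^{-z}) ∩₂ 𝔖₁(e^{1-z})`, with value `∞` outside this space. -/
def interNorm (C : SequentialCouple X₀ X₁ V E₀ E₁) (z : ℂ) (x : ℤ → C.Sum) : ℝ≥0∞ :=
  (C.S₀.weightedNorm C.ι₀ (Complex.exp (-z)) x ^ 2 +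
    C.S₁.weightedNorm C.ι₁ (Complex.exp (1 - z)) x ^ 2) ^ (1 / 2 : ℝ)

/-- The norm `‖x‖_{z,2}` of the interpolation space `𝒳_z^{(2)}`, with value `∞` outside it. -/
def interpNorm (C : SequentialCouple X₀ X₁ V E₀ E₁) (z : ℂ) (x : C.Sum) : ℝ≥0∞ :=
  ⨅ (s : ℤ → C.Sum) (_ : HasSum s x), C.interNorm z s

/-- The unit sphere of the interpolation space `𝒳_z^{(2)}`. -/
def interpSphere (C : SequentialCouple X₀ X₁ V E₀ E₁) (z : ℂ) : Set C.Sum :=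
  {x | C.interpNorm z x = 1}

/-- The Fourier coefficients `(2π)⁻¹ ∫_0^{2π} f(z + it) e^{-ikt} dt` of `t ↦ f(z + it)`. -/
def fourierCoef (C : SequentialCouple X₀ X₁ V E₀ E₁) (f : ℂ → C.Sum) (z : ℂ) (k : ℤ) : C.Sum :=
  ((2 * Real.pi : ℝ) : ℂ)⁻¹ • ∫ t in (0 : ℝ)..(2 * Real.pi),
    Complex.exp (-(Complex.I * k * t)) • f (z + Complex.I * t)

/-- The norm of `ℋ²_π`, computed at the base point `1/2` (it does not depend on the base point
in the strip). -/
def hardyNorm (C : SequentialCouple X₀ X₁ V E₀ E₁) (f : ℂ → C.Sum) : ℝ≥0∞ :=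
  C.interNorm (1 / 2) (C.fourierCoef f (1 / 2))

/-- Membership in `ℋ²_π`: `f` is analytic on the strip with values in `X₀ + X₁`, is
`2πi`-periodic, and has finite norm.  Values off the strip are irrelevant. -/
structure MemHardy (C : SequentialCouple X₀ X₁ V E₀ E₁) (f : ℂ → C.Sum) : Prop where
  analytic : DifferentiableOn ℂ f unitStrip
  periodic : ∀ z ∈ unitStrip, f (z + 2 * Real.pi * Complex.I) = f z
  finite : C.hardyNorm f < ⊤

/-- `f` is an optimal function associated to `x` at `z`: `f ∈ ℋ²_π`, `f(z) = x` and
`‖f‖ = ‖x‖_{z,2}`. -/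
structure IsOptimal (C : SequentialCouple X₀ X₁ V E₀ E₁) (z : ℂ) (x : C.Sum)
    (f : ℂ → C.Sum) : Prop where
  mem : C.MemHardy f
  eval : f z = x
  norm_eq : C.hardyNorm f = C.interpNorm z x

/-- The optimal function `Γ_z(x)` associated to `x` at `z`. -/
def optimalFunction (C : SequentialCouple X₀ X₁ V E₀ E₁) (z : ℂ) (x : C.Sum) : ℂ → C.Sum :=
  Classical.epsilon (C.IsOptimal z x)

/-- The map `U_{z,w}(x) = Γ_z(x)(w)`. -/
def transfer (C : SequentialCouple X₀ X₁ V E₀ E₁) (z w : ℂ) (x : C.Sum) : C.Sum :=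
  C.optimalFunction z x w

/-- The modulus of continuity
`ε ↦ sup {‖U_{z,w}(x) - U_{z,w}(y)‖_{w,2} : ‖x‖_{z,2} = ‖y‖_{z,2} = 1, ‖x - y‖_{z,2} ≤ ε}`. -/
def transferModulus (C : SequentialCouple X₀ X₁ V E₀ E₁) (z w : ℂ) (ε : ℝ≥0) : ℝ≥0∞ :=
  ⨆ (x ∈ C.interpSphere z) (y ∈ C.interpSphere z) (_ : C.interpNorm z (x - y) ≤ ε),
    C.interpNorm w (C.transfer z w x - C.transfer z w y)

end SequentialCouple

end

/-! An analytic periodic function on the strip is $f(z)=\sum_k e^{kz}x_k$. In the weighted norms at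
$z$ the factors $e^{\pm kz}$ cancel, so the norm of $f$ is that of the pair $((x_k),(e^kx_k))$ in
$\mathfrak{S}_0\oplus_2\mathfrak{S}_1$, whatever $z$ is. All the spaces $\mathcal{X}_z^{(2)}$ are
therefore quotients of one space, `HardySpace`, by the kernels of the evaluations at $z$
(`pairNorm_eq_enorm`, `iInf_pairNorm_eq_fiberNorm`). It is a closed subspace of an $\ell^2$-sum of
uniformly convex spaces, hence uniformly convex and complete.

An optimal function is an element of minimal norm in a fibre of the evaluation, a closed affine
subspace; it exists and is unique by uniform convexity.

For the modulus, let $p,q$ be optimal over unit vectors $x,y$, and let $r$ lie over $x-y$ with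
$\|r\|\le\epsilon$. Then $(p+q+r)/2$ lies over $x$, so its norm is at least 1 and
$\|p+q\|\ge2-\epsilon$. Uniform convexity makes $\|p-q\|$ small, at a rate depending only on the
Hardy space, and evaluation at $w$ does not increase norms (`enorm_sub_le_rotundityModulus`,
`transferModulus_le`). -/

section UniformConvexity

/-! ### Uniform convexity: products, minimal norm, modulus -/

variable {E F : Type*} [NormedAddCommGroup E] [NormedAddCommGroup F]

lemma norm_add_sq_le_two_mul (a b : E) : ‖a + b‖ ^ 2 ≤ 2 * ‖a‖ ^ 2 + 2 * ‖b‖ ^ 2 := by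
  have h := norm_add_le a b
  nlinarith [sq_nonneg (‖a‖ - ‖b‖), norm_nonneg (a + b), norm_nonneg a, norm_nonneg b]

/-- A quantitative form of the parallelogram inequality in uniformly convex spaces. -/
lemma UniformConvexSpace.exists_norm_add_sq_le [NormedSpace ℝ E] [UniformConvexSpace E]
    {ε R : ℝ} (hε : 0 < ε) (hR : 0 < R) :
    ∃ η, 0 < η ∧ ∀ a b : E, ‖a‖ ≤ R → ‖b‖ ≤ R → ε ≤ ‖a - b‖ →
      ‖a + b‖ ^ 2 ≤ 2 * ‖a‖ ^ 2 + 2 * ‖b‖ ^ 2 - η := by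
  obtain ⟨δ, hδ, h⟩ := exists_forall_closed_ball_dist_add_le_two_sub E (div_pos hε hR)
  -- After division by the larger norm $M\ge\epsilon/2$, convexity saves $\delta
  -- M\ge\delta\epsilon/2=2d$.
  set d := δ * ε / 4 with hd
  have hd0 : 0 < d := by positivity
  have key : ∀ a b : E, ‖b‖ ≤ ‖a‖ → ‖a‖ ≤ R → ε ≤ ‖a - b‖ → ‖a + b‖ ≤ 2 * ‖a‖ - 2 * d := by
    intro a b hba ha hab
    have hM : ε / 2 ≤ ‖a‖ := by linarith [norm_sub_le a b]
    have hM0 : 0 < ‖a‖ := by linarith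
    have hs : ∀ c : E, ‖‖a‖⁻¹ • c‖ = ‖c‖ / ‖a‖ := fun c => by
      rw [norm_smul, norm_inv, norm_norm, inv_mul_eq_div]
    have h1 := @h (‖a‖⁻¹ • a) (by rw [hs, div_self hM0.ne']) (‖a‖⁻¹ • b)
      (by rw [hs]; exact (div_le_one hM0).2 hba)
      (by
        rw [← smul_sub, hs]
        exact div_le_div₀ (norm_nonneg _) hab hM0 ha)
    rw [← smul_add, hs, div_le_iff₀ hM0] at h1
    nlinarith
  refine ⟨d ^ 2, by positivity, fun a b ha hb hab => ?_⟩
  have htri := norm_add_le a b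
  have hn := norm_nonneg (a + b)
  -- If the norms differ by $d$, the term $(\|a\|-\|b\|)^2$ lost in the scalar inequality is the
  -- gain. Otherwise twice the larger norm is at most $\|a\|+\|b\|+d$, and `key` still saves $d$.
  rcases le_total d |‖a‖ - ‖b‖| with hd1 | hd1
  · have : d ^ 2 ≤ (‖a‖ - ‖b‖) ^ 2 := by
      rw [← sq_abs (‖a‖ - ‖b‖)]; exact pow_le_pow_left₀ hd0.le hd1 2
    nlinarith [norm_nonneg a, norm_nonneg b]
  · have h2 : ‖a + b‖ ≤ ‖a‖ + ‖b‖ - d := by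
      rw [abs_le] at hd1
      rcases le_total ‖b‖ ‖a‖ with hba | hba
      · linarith [key a b hba ha hab]
      · have := key b a hba hb (by rwa [norm_sub_rev])
        rw [add_comm b a] at this
        linarith
    nlinarith [sq_nonneg (‖a‖ - ‖b‖)]

/-- Two unit vectors at distance $\epsilon$ are at distance at least $\epsilon/2$ in some
coordinate. That coordinate gains $\eta$ in the parallelogram inequality, the other loses nothing.
-/
instance WithLp.uniformConvexSpace_prod [NormedSpace ℝ E] [NormedSpace ℝ F]
    [UniformConvexSpace E] [UniformConvexSpace F] :
    UniformConvexSpace (WithLp 2 (E × F)) := by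
  refine ⟨fun ε hε => ?_⟩
  obtain ⟨η₀, hη₀, h₀⟩ := UniformConvexSpace.exists_norm_add_sq_le (E := E)
    (half_pos hε) one_pos
  obtain ⟨η₁, hη₁, h₁⟩ := UniformConvexSpace.exists_norm_add_sq_le (E := F)
    (half_pos hε) one_pos
  have hη : 0 < min (min η₀ η₁) 1 := by positivity
  -- The choice works because $(2-\eta/4)^2\ge4-\eta$; the cap at 1 keeps $2-\eta/4$ positive.
  refine ⟨min (min η₀ η₁) 1 / 4, by positivity, fun x hx y hy hxy => ?_⟩
  set η := min (min η₀ η₁) 1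
  have hηle0 : η ≤ η₀ := (min_le_left _ _).trans (min_le_left _ _)
  have hηle1 : η ≤ η₁ := (min_le_left _ _).trans (min_le_right _ _)
  have hηle : η ≤ 1 := min_le_right _ _
  have ex := WithLp.prod_norm_sq_eq_of_L2 x
  have ey := WithLp.prod_norm_sq_eq_of_L2 y
  have ea := WithLp.prod_norm_sq_eq_of_L2 (x + y)
  have es := WithLp.prod_norm_sq_eq_of_L2 (x - y)
  rw [hx] at ex
  rw [hy] at ey
  rw [WithLp.add_fst, WithLp.add_snd] at ea
  rw [WithLp.sub_fst, WithLp.sub_snd] at es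
  have bnd : ∀ {s t : ℝ}, (1 : ℝ) ^ 2 = s ^ 2 + t ^ 2 → s ≤ 1 ∧ t ≤ 1 := fun {s t} hst => by
    constructor <;> nlinarith [sq_nonneg s, sq_nonneg t]
  have hmain : ‖x + y‖ ^ 2 ≤ 4 - η := by
    rcases le_total (ε / 2) ‖x.fst - y.fst‖ with hc | hc
    · nlinarith [h₀ _ _ (bnd ex).1 (bnd ey).1 hc, norm_add_sq_le_two_mul x.snd y.snd]
    · have hc' : ε / 2 ≤ ‖x.snd - y.snd‖ := by
        by_contra! hlt
        nlinarith [norm_nonneg (x.fst - y.fst), norm_nonneg (x.snd - y.snd)]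
      nlinarith [h₁ _ _ (bnd ex).2 (bnd ey).2 hc', norm_add_sq_le_two_mul x.fst y.fst]
  refine abs_le_of_sq_le_sq' ?_ (by linarith) |>.2
  nlinarith [sq_nonneg η]

lemma Submodule.uniformConvexSpace {𝕜 : Type*} [NormedField 𝕜] [NormedSpace 𝕜 E]
    [UniformConvexSpace E] (K : Submodule 𝕜 E) : UniformConvexSpace K := by
  refine ⟨fun ε hε => ?_⟩
  obtain ⟨δ, hδ, h⟩ := exists_forall_sphere_dist_add_le_two_sub E hε
  exact ⟨δ, hδ, fun x hx y hy hxy => h hx hy hxy⟩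

/-- A nonempty closed convex set in a complete uniformly convex space has an element of minimal
norm. -/
lemma UniformConvexSpace.exists_norm_le_of_isClosed_of_convex [NormedSpace ℝ E]
    [UniformConvexSpace E] [CompleteSpace E] {K : Set E} (hne : K.Nonempty) (hcl : IsClosed K)
    (hco : Convex ℝ K) : ∃ x ∈ K, ∀ y ∈ K, ‖x‖ ≤ ‖y‖ := by
  set d := sInf (norm '' K) with hd
  have hbdd : BddBelow (norm '' K) := ⟨0, by rintro _ ⟨y, -, rfl⟩; exact norm_nonneg y⟩
  have hdle : ∀ y ∈ K, d ≤ ‖y‖ := fun y hy => csInf_le hbdd ⟨y, hy, rfl⟩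
  have hd0 : 0 ≤ d := le_csInf (hne.image _) (by rintro _ ⟨y, -, rfl⟩; exact norm_nonneg y)
  obtain ⟨s, -, hs, hsK⟩ := exists_seq_tendsto_sInf (hne.image norm) hbdd
  choose u huK hu using hsK
  have hs' : Tendsto (fun n => ‖u n‖) atTop (𝓝 d) := by simpa only [hu] using hs
  have hcau : CauchySeq u := by
    rw [Metric.cauchySeq_iff]
    intro ε hε
    obtain ⟨η, hη, h⟩ := UniformConvexSpace.exists_norm_add_sq_le (E := E) hε
      (R := d + 1) (by positivity)
    have e1 : ∀ᶠ n in atTop, ‖u n‖ < d + 1 := hs'.eventually_lt_const (by linarith)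
    -- Two such terms at distance $\epsilon$ would give $\|u_m+u_n\|^2<4d^2$, whereas their midpoint
    -- lies in $K$ and has norm at least $d$.
    have e2 : ∀ᶠ n in atTop, ‖u n‖ ^ 2 < d ^ 2 + η / 4 :=
      (hs'.pow 2).eventually_lt_const (by linarith)
    obtain ⟨N, hN⟩ := eventually_atTop.1 (e1.and e2)
    refine ⟨N, fun m hm n hn => ?_⟩
    by_contra! hc
    rw [dist_eq_norm] at hc
    have h1 := h _ _ (hN m hm).1.le (hN n hn).1.le hc
    have h2 := hdle _ (hco (huK m) (huK n) (by norm_num : (0 : ℝ) ≤ 1 / 2)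
      (by norm_num : (0 : ℝ) ≤ 1 / 2) (by norm_num))
    rw [← smul_add, norm_smul, Real.norm_of_nonneg (by norm_num)] at h2
    nlinarith [(hN m hm).2, (hN n hn).2]
  obtain ⟨x, hx⟩ := cauchySeq_tendsto_of_complete hcau
  refine ⟨x, hcl.mem_of_tendsto hx (Eventually.of_forall huK), fun y hy => ?_⟩
  rw [tendsto_nhds_unique hx.norm hs']
  exact hdle y hy

/-- In a strictly convex space, elements of minimal norm in a convex set are unique. -/
lemma eq_of_minimal_norm_of_convex [NormedSpace ℝ E] [StrictConvexSpace ℝ E] {K : Set E}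
    (hco : Convex ℝ K) {x y : E} (hx : x ∈ K) (hy : y ∈ K) (hxm : ∀ u ∈ K, ‖x‖ ≤ ‖u‖)
    (hym : ∀ u ∈ K, ‖y‖ ≤ ‖u‖) : x = y := by
  have hxy : ‖x‖ = ‖y‖ := le_antisymm (hxm y hy) (hym x hx)
  by_contra hne
  have h1 := norm_combo_lt_of_ne (r := ‖x‖) le_rfl hxy.ge hne
    (by norm_num : (0 : ℝ) < 1 / 2) (by norm_num : (0 : ℝ) < 1 / 2) (by norm_num)
  exact absurd (hxm _ (hco hx hy (by norm_num : (0 : ℝ) ≤ 1 / 2)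
    (by norm_num : (0 : ℝ) ≤ 1 / 2) (by norm_num))) (not_le.2 h1)

/-- The modulus `ε ↦ sup {‖x - y‖ : ‖x‖ = ‖y‖ = 1, ‖x + y‖ ≥ 2 - ε}`, inverse to the modulus of
convexity. -/
noncomputable def rotundityModulus (E : Type*) [NormedAddCommGroup E] (ε : ℝ≥0) : ℝ≥0 :=
  sSup {r | ∃ x y : E, ‖x‖ = 1 ∧ ‖y‖ = 1 ∧ 2 - (ε : ℝ) ≤ ‖x + y‖ ∧ r = ‖x - y‖₊}

lemma nnnorm_sub_le_rotundityModulus {ε : ℝ≥0} {x y : E} (hx : ‖x‖ = 1) (hy : ‖y‖ = 1)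
    (hxy : 2 - (ε : ℝ) ≤ ‖x + y‖) : ‖x - y‖₊ ≤ rotundityModulus E ε := by
  -- The bound 2 is needed: the supremum of an unbounded set in `ℝ≥0` is 0 by default.
  refine le_csSup ⟨2, ?_⟩ ⟨x, y, hx, hy, hxy, rfl⟩
  rintro _ ⟨u, v, hu, hv, -, rfl⟩
  rw [← NNReal.coe_le_coe, coe_nnnorm]
  exact (norm_sub_le u v).trans (by rw [hu, hv]; norm_num)

lemma tendsto_rotundityModulus [UniformConvexSpace E] :
    Tendsto (rotundityModulus E) (𝓝 0) (𝓝 0) := by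
  refine tendsto_order.2 ⟨fun a ha => absurd ha (not_lt.2 zero_le), fun η hη => ?_⟩
  have hη2 : (0 : ℝ) < η / 2 := half_pos (NNReal.coe_pos.2 hη)
  obtain ⟨δ, hδ, h⟩ := exists_forall_sphere_dist_add_le_two_sub E hη2
  filter_upwards [Iio_mem_nhds (show (0 : ℝ≥0) < ⟨δ, hδ.le⟩ from hδ)] with ε hε
  have hε' : (ε : ℝ) < δ := hε
  -- Aiming at $\eta/2$ keeps the inequality strict after the supremum; `csSup_le'` also covers the
  -- empty set, which occurs when $E=0$.
  refine lt_of_le_of_lt (csSup_le' ?_) (NNReal.half_lt_self hη.ne')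
  rintro _ ⟨x, y, hx, hy, hxy, rfl⟩
  by_contra! hc
  have hc' : (η : ℝ) / 2 ≤ ‖x - y‖ := by
    have := NNReal.coe_le_coe.2 hc.le
    simpa using this
  linarith [h hx hy hc']

end UniformConvexity

/-! ### The strip and weighted sequence norms -/

set_option linter.unusedSectionVars false

noncomputable section

lemma summable_exp_neg_mul_abs_int {r : ℝ} (hr : 0 < r) :
    Summable fun k : ℤ => Real.exp (-(r * |(k : ℝ)|)) := by
  have h : Summable fun n : ℕ => Real.exp (-(r * |((n : ℤ) : ℝ)|)) := by
    have := summable_geometric_of_lt_one (Real.exp_pos (-r)).le (Real.exp_lt_one_iff.2 (by linarith))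
    refine this.congr fun n => ?_
    rw [← Real.exp_nat_mul, Int.cast_natCast, Nat.abs_cast]
    ring_nf
  refine Summable.of_nat_of_neg h (h.congr fun n => ?_)
  rw [Int.cast_neg, abs_neg]

lemma isOpen_unitStrip : IsOpen unitStrip :=
  (isOpen_lt continuous_const Complex.continuous_re).inter
    (isOpen_lt Complex.continuous_re continuous_const)

lemma convex_unitStrip : Convex ℝ unitStrip :=
  (convex_halfSpace_re_gt 0).inter (convex_halfSpace_re_lt 1)

namespace SequenceStructure

variable {X E W : Type*} [NormedAddCommGroup X] [NormedSpace ℂ X]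
  [NormedAddCommGroup E] [NormedSpace ℂ E] [AddCommGroup W] [Module ℂ W]

lemma seqNorm_toSeq (S : SequenceStructure X E) (e : E) : S.seqNorm (S.toSeq e) = ‖e‖ₑ := by
  refine le_antisymm (biInf_le (fun e => ‖e‖ₑ) rfl) (le_iInf₂ fun e' he' => ?_)
  rw [S.toSeq_injective he']

lemma weightedNorm_eq (S : SequenceStructure X E) {ι : X →ₗ[ℂ] W} (hι : Function.Injective ι)
    {a : ℂ} (ha : a ≠ 0) {x : ℤ → W} {e : E} (h : ∀ k, a ^ k • x k = ι (S.toSeq e k)) :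
    S.weightedNorm ι a x = ‖e‖ₑ := by
  rw [← S.seqNorm_toSeq e]
  refine le_antisymm ((iInf₂_le (fun k => (a ^ k)⁻¹ • S.toSeq e k) fun k => ?_).trans_eq ?_)
    (le_iInf₂ fun u hu => le_of_eq ?_)
  · rw [map_smul, ← h k, inv_smul_smul₀ (zpow_ne_zero k ha)]
  · congr 1
    ext k
    exact smul_inv_smul₀ (zpow_ne_zero k ha) _
  · congr 1
    ext k
    exact hι (by rw [map_smul, hu k, h k])

lemma exists_of_weightedNorm_lt_top (S : SequenceStructure X E) {ι : X →ₗ[ℂ] W} {a : ℂ}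
    {x : ℤ → W} (h : S.weightedNorm ι a x < ⊤) :
    ∃ e : E, ∀ k, a ^ k • x k = ι (S.toSeq e k) := by
  simp only [weightedNorm, seqNorm, iInf_lt_iff] at h
  obtain ⟨u, hu, e, he, -⟩ := h
  exact ⟨e, fun k => by rw [he, map_smul, hu k]⟩

/-- The coordinate functional `x ↦ x_k` on a sequence structure. -/
def applyL (S : SequenceStructure X E) (k : ℤ) : E →L[ℂ] X :=
  (LinearMap.proj k ∘ₗ S.toSeq).mkContinuous 1 fun e => by
    rw [one_mul]; exact S.norm_apply_le e k

@[simp]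
lemma applyL_apply (S : SequenceStructure X E) (k : ℤ) (e : E) :
    S.applyL k e = S.toSeq e k := rfl

end SequenceStructure

/-! ### The Hardy space and its coefficients -/

namespace SequentialCouple

section Banach

variable {X₀ X₁ Y E₀ E₁ : Type*}
  [NormedAddCommGroup X₀] [NormedSpace ℂ X₀] [NormedAddCommGroup X₁] [NormedSpace ℂ X₁]
  [NormedAddCommGroup Y] [NormedSpace ℂ Y]
  [NormedAddCommGroup E₀] [NormedSpace ℂ E₀] [NormedAddCommGroup E₁] [NormedSpace ℂ E₁]
  (D : SequentialCouple X₀ X₁ Y E₀ E₁)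

/-- The space `𝔖₀ ∩₂ 𝔖₁(e)`, realized as the pairs `(x, y)` in `𝔖₀ ⊕₂ 𝔖₁` with
`y_k = e^k x_k`. -/
def hardySubmodule : Submodule ℂ (WithLp 2 (E₀ × E₁)) :=
  ⨅ k : ℤ, LinearMap.ker
    (D.j₁ ∘L D.S₁.applyL k ∘L WithLp.sndL 2 ℂ E₀ E₁ -
      Complex.exp k • D.j₀ ∘L D.S₀.applyL k ∘L WithLp.fstL 2 ℂ E₀ E₁).toLinearMap

lemma mem_hardySubmodule {p : WithLp 2 (E₀ × E₁)} :
    p ∈ D.hardySubmodule ↔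
      ∀ k : ℤ, D.j₁ (D.S₁.toSeq p.snd k) = Complex.exp k • D.j₀ (D.S₀.toSeq p.fst k) := by
  simp [hardySubmodule, sub_eq_zero]

lemma isClosed_hardySubmodule : IsClosed (D.hardySubmodule : Set (WithLp 2 (E₀ × E₁))) := by
  rw [hardySubmodule, Submodule.coe_iInf]
  exact isClosed_iInter fun k => ContinuousLinearMap.isClosed_ker _

/-- The Hardy space of the couple, with elements given by their coefficients. -/
def HardySpace : Type _ := D.hardySubmodule

instance : NormedAddCommGroup D.HardySpace :=
  inferInstanceAs (NormedAddCommGroup D.hardySubmodule)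

instance : NormedSpace ℂ D.HardySpace := inferInstanceAs (NormedSpace ℂ D.hardySubmodule)

instance [CompleteSpace E₀] [CompleteSpace E₁] : CompleteSpace D.HardySpace :=
  D.isClosed_hardySubmodule.completeSpace_coe

instance [UniformConvexSpace E₀] [UniformConvexSpace E₁] : UniformConvexSpace D.HardySpace :=
  D.hardySubmodule.uniformConvexSpace

/-- The inclusion of the Hardy space in `𝔖₀ ⊕₂ 𝔖₁`. -/
def toPair : D.HardySpace →ₗᵢ[ℂ] WithLp 2 (E₀ × E₁) := D.hardySubmodule.subtypeₗᵢ

/-- The `k`-th coefficient of an element of the Hardy space. -/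
def coef (k : ℤ) : D.HardySpace →L[ℂ] Y :=
  D.j₀ ∘L D.S₀.applyL k ∘L WithLp.fstL 2 ℂ E₀ E₁ ∘L D.toPair.toContinuousLinearMap

lemma coef_apply (k : ℤ) (p : D.HardySpace) :
    D.coef k p = D.j₀ (D.S₀.toSeq (D.toPair p).fst k) := rfl

lemma exp_smul_coef (k : ℤ) (p : D.HardySpace) :
    Complex.exp k • D.coef k p = D.j₁ (D.S₁.toSeq (D.toPair p).snd k) :=
  (D.mem_hardySubmodule.1 (Subtype.property p) k).symm

lemma norm_coef_apply_le (k : ℤ) (p : D.HardySpace) :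
    ‖D.coef k p‖ ≤ max ‖D.j₀‖ ‖D.j₁‖ * ‖p‖ := by
  rw [coef_apply]
  refine (D.j₀.le_opNorm _).trans (mul_le_mul (le_max_left _ _) ?_ (norm_nonneg _) (by positivity))
  exact (D.S₀.norm_apply_le _ k).trans (WithLp.norm_fst_le _ (D.toPair p))

lemma exp_mul_norm_coef_apply_le (k : ℤ) (p : D.HardySpace) :
    Real.exp k * ‖D.coef k p‖ ≤ max ‖D.j₀‖ ‖D.j₁‖ * ‖p‖ := by
  have h : Real.exp k * ‖D.coef k p‖ = ‖Complex.exp k • D.coef k p‖ := by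
    rw [norm_smul, Complex.norm_exp, Complex.intCast_re]
  rw [h, exp_smul_coef]
  refine (D.j₁.le_opNorm _).trans (mul_le_mul (le_max_right _ _) ?_ (norm_nonneg _) (by positivity))
  exact (D.S₁.norm_apply_le _ k).trans (WithLp.norm_snd_le _ (D.toPair p))

/-- The $\mathfrak{S}_0$-component bounds $x_k$ and the $\mathfrak{S}_1$-component bounds $e^kx_k$.
The first yields decay of $e^{kz}x_k$ for $k\le0$, the second for $k\ge0$, uniformly for
$r\le\operatorname{Re}z\le1-r$. -/
lemma norm_exp_smul_coef_le {r : ℝ} {z : ℂ} (h0 : r ≤ z.re) (h1 : r ≤ 1 - z.re) (k : ℤ) :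
    ‖Complex.exp (k * z) • D.coef k‖ ≤ Real.exp (-(r * |(k : ℝ)|)) * max ‖D.j₀‖ ‖D.j₁‖ := by
  refine ContinuousLinearMap.opNorm_le_bound _ (by positivity) fun p => ?_
  have hre : ((k : ℂ) * z).re = k * z.re := by simp
  rw [smul_apply, norm_smul, Complex.norm_exp, hre, mul_assoc (Real.exp _)]
  rcases le_total (0 : ℝ) k with hk | hk
  · have e : Real.exp (k * z.re) = Real.exp (k * z.re - k) * Real.exp k := by
      rw [← Real.exp_add, sub_add_cancel]
    rw [e, mul_assoc]
    refine mul_le_mul (Real.exp_le_exp.2 ?_) (D.exp_mul_norm_coef_apply_le k p)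
      (by positivity) (Real.exp_pos _).le
    rw [abs_of_nonneg hk]
    nlinarith
  · refine mul_le_mul (Real.exp_le_exp.2 ?_) (D.norm_coef_apply_le k p)
      (by positivity) (Real.exp_pos _).le
    rw [abs_of_nonpos hk]
    nlinarith

/-- The value `∑ e^{kz} x_k` at `z` of the function with coefficients `x`. -/
def evalAt (z : ℂ) : D.HardySpace →L[ℂ] Y := ∑' k : ℤ, Complex.exp (k * z) • D.coef k

/-- The norm of `𝔖₀(e^{-z}) ∩₂ 𝔖₁(e^{1-z})`, for sequences in the Banach space `Y`. -/
def pairNorm (z : ℂ) (x : ℤ → Y) : ℝ≥0∞ :=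
  (D.S₀.weightedNorm (D.j₀ : X₀ →ₗ[ℂ] Y) (Complex.exp (-z)) x ^ 2 +
    D.S₁.weightedNorm (D.j₁ : X₁ →ₗ[ℂ] Y) (Complex.exp (1 - z)) x ^ 2) ^ (1 / 2 : ℝ)

/-- The weights $e^{-kz}$ and $e^{k(1-z)}$ turn $e^{kz}x_k$ into $x_k$ and $e^kx_k$, so $z$
disappears. -/
lemma pairNorm_eq_enorm (z : ℂ) (p : D.HardySpace) :
    D.pairNorm z (fun k => Complex.exp (k * z) • D.coef k p) = ‖p‖ₑ := by
  have h0 : D.S₀.weightedNorm (D.j₀ : X₀ →ₗ[ℂ] Y) (Complex.exp (-z))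
      (fun k => Complex.exp (k * z) • D.coef k p) = ‖(D.toPair p).fst‖ₑ := by
    refine D.S₀.weightedNorm_eq D.j₀_injective (Complex.exp_ne_zero _) fun k => ?_
    refine Eq.trans ?_ (D.coef_apply k p)
    rw [← Complex.exp_int_mul, smul_smul, ← Complex.exp_add,
      show (k : ℂ) * -z + k * z = 0 by ring, Complex.exp_zero, one_smul]
  have h1 : D.S₁.weightedNorm (D.j₁ : X₁ →ₗ[ℂ] Y) (Complex.exp (1 - z))
      (fun k => Complex.exp (k * z) • D.coef k p) = ‖(D.toPair p).snd‖ₑ := by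
    refine D.S₁.weightedNorm_eq D.j₁_injective (Complex.exp_ne_zero _) fun k => ?_
    refine Eq.trans ?_ (D.exp_smul_coef k p)
    rw [← Complex.exp_int_mul, smul_smul, ← Complex.exp_add,
      show (k : ℂ) * (1 - z) + k * z = k by ring]
  have hp : ‖p‖ = (‖(D.toPair p).fst‖ ^ 2 +
      ‖(D.toPair p).snd‖ ^ 2) ^ (1 / 2 : ℝ) := by
    rw [← Real.sqrt_eq_rpow, ← WithLp.prod_norm_eq_of_L2, LinearIsometry.norm_map]
  rw [pairNorm, h0, h1, ← ofReal_norm p, hp,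
    ← ENNReal.ofReal_rpow_of_nonneg (by positivity) (by norm_num),
    ENNReal.ofReal_add (by positivity) (by positivity), ENNReal.ofReal_pow (norm_nonneg _),
    ENNReal.ofReal_pow (norm_nonneg _), ofReal_norm, ofReal_norm]

/-- The ratio of the weights at $z$ is $e^k$, exactly the relation between the components of a Hardy
space element. -/
lemma exists_eq_of_pairNorm_lt_top {z : ℂ} {s : ℤ → Y} (h : D.pairNorm z s < ⊤) :
    ∃ p : D.HardySpace, s = fun k : ℤ => Complex.exp (k * z) • D.coef k p := by
  rw [pairNorm, ENNReal.rpow_lt_top_iff_of_pos (by norm_num), ENNReal.add_lt_top] at h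
  obtain ⟨e₀, h0⟩ := D.S₀.exists_of_weightedNorm_lt_top
    (ENNReal.pow_lt_top_iff.1 h.1 |>.resolve_right two_ne_zero)
  obtain ⟨e₁, h1⟩ := D.S₁.exists_of_weightedNorm_lt_top
    (ENNReal.pow_lt_top_iff.1 h.2 |>.resolve_right two_ne_zero)
  have hs : ∀ k : ℤ, s k = Complex.exp (k * z) • D.j₀ (D.S₀.toSeq e₀ k) := fun k => by
    refine Eq.trans ?_ (congrArg _ (h0 k))
    rw [← Complex.exp_int_mul, smul_smul, ← Complex.exp_add,
      show (k : ℂ) * z + k * -z = 0 by ring, Complex.exp_zero, one_smul]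
  refine ⟨⟨WithLp.toLp 2 (e₀, e₁), D.mem_hardySubmodule.2 fun k => ?_⟩, funext hs⟩
  rw [WithLp.toLp_fst, WithLp.toLp_snd]
  refine (h1 k).symm.trans (Eq.trans ?_ (congrArg _ (h0 k)))
  rw [
    ← Complex.exp_int_mul, ← Complex.exp_int_mul, smul_smul, ← Complex.exp_add]
  ring_nf

/-! ### Evaluation, analyticity and Fourier coefficients -/

section Complete

variable [CompleteSpace Y]

lemma summable_exp_smul_coef {z : ℂ} (hz : z ∈ unitStrip) :
    Summable fun k : ℤ => Complex.exp (k * z) • D.coef k :=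
  .of_norm_bounded ((summable_exp_neg_mul_abs_int (lt_min hz.1 (sub_pos.2 hz.2))).mul_right _)
    (D.norm_exp_smul_coef_le (min_le_left _ _) (min_le_right _ _))

lemma hasSum_evalAt {z : ℂ} (hz : z ∈ unitStrip) (p : D.HardySpace) :
    HasSum (fun k : ℤ => Complex.exp (k * z) • D.coef k p) (D.evalAt z p) := by
  have h : HasSum (fun k : ℤ => Complex.exp (k * z) • D.coef k) (D.evalAt z) :=
    (D.summable_exp_smul_coef hz).hasSum
  have h' := h.mapL (ContinuousLinearMap.apply ℂ Y p)
  simpa only [ContinuousLinearMap.apply_apply, smul_apply] using h'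

lemma differentiableOn_evalAt : DifferentiableOn ℂ D.evalAt unitStrip := by
  intro z hz
  -- On the thinner strip around $z$ one summable series dominates the terms in operator norm.
  obtain ⟨r, hr0, hr⟩ := exists_between (lt_min hz.1 (sub_pos.2 hz.2))
  have hU : IsOpen {w : ℂ | r < w.re ∧ w.re < 1 - r} :=
    (isOpen_lt continuous_const Complex.continuous_re).inter
      (isOpen_lt Complex.continuous_re continuous_const)
  have hzU : z ∈ {w : ℂ | r < w.re ∧ w.re < 1 - r} :=
    ⟨hr.trans_le (min_le_left _ _), by linarith [hr.trans_le (min_le_right z.re (1 - z.re))]⟩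
  refine DifferentiableAt.differentiableWithinAt ?_
  refine (Complex.differentiableOn_tsum_of_summable_norm ((summable_exp_neg_mul_abs_int hr0).mul_right (max ‖D.j₀‖ ‖D.j₁‖))
    (fun k => ?_) hU fun k w hw => ?_).differentiableAt (hU.mem_nhds hzU)
  · exact Differentiable.differentiableOn (by fun_prop)
  · exact D.norm_exp_smul_coef_le hw.1.le (by linarith [hw.2]) k

lemma differentiableOn_evalAt_apply (p : D.HardySpace) :
    DifferentiableOn ℂ (fun z => D.evalAt z p) unitStrip :=
  D.differentiableOn_evalAt.clm_apply (differentiableOn_const p)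

lemma evalAt_add_two_pi_I (z : ℂ) : D.evalAt (z + 2 * Real.pi * Complex.I) = D.evalAt z := by
  refine tsum_congr fun k => ?_
  rw [mul_add, Complex.exp_add, Complex.exp_int_mul_two_pi_mul_I, mul_one]

lemma integral_exp_mul_exp (n k : ℤ) :
    ∫ t in (0 : ℝ)..(2 * Real.pi),
      Complex.exp (-(Complex.I * k * t)) * Complex.exp (Complex.I * n * t) =
      if n = k then ((2 * Real.pi : ℝ) : ℂ) else 0 := by
  split_ifs with h
  · subst h
    simp [← Complex.exp_add]
  · have hc : Complex.I * ((n : ℂ) - k) ≠ 0 :=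
      mul_ne_zero Complex.I_ne_zero (sub_ne_zero.2 (Int.cast_injective.ne h))
    have e : ∀ t : ℝ, Complex.exp (-(Complex.I * k * t)) * Complex.exp (Complex.I * n * t) =
        Complex.exp (Complex.I * ((n : ℂ) - k) * t) := fun t => by
      rw [← Complex.exp_add]; ring_nf
    simp_rw [e]
    rw [integral_exp_mul_complex hc]
    have : Complex.I * ((n : ℂ) - k) * ((2 * Real.pi : ℝ) : ℂ) =
        ((n - k : ℤ) : ℂ) * (2 * Real.pi * Complex.I) := by push_cast; ring
    rw [this, Complex.exp_int_mul_two_pi_mul_I]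
    simp

lemma mem_unitStrip_add_I_mul {z : ℂ} (hz : z ∈ unitStrip) (t : ℝ) :
    z + Complex.I * t ∈ unitStrip := by
  simpa [unitStrip] using hz

/-- Exponential decay permits termwise integration, and orthogonality leaves only the $k$-th term.
-/
lemma fourierCoef_evalAt {z : ℂ} (hz : z ∈ unitStrip) (p : D.HardySpace) (k : ℤ) :
    ((2 * Real.pi : ℝ) : ℂ)⁻¹ • ∫ t in (0 : ℝ)..(2 * Real.pi),
      Complex.exp (-(Complex.I * k * t)) • D.evalAt (z + Complex.I * t) p = Complex.exp (k * z) • D.coef k p := by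
  set r := min z.re (1 - z.re)
  have hr : 0 < r := lt_min hz.1 (sub_pos.2 hz.2)
  set F : ℤ → ℝ → Y := fun n t => Complex.exp (-(Complex.I * k * t)) •
    (Complex.exp (n * (z + Complex.I * t)) • D.coef n p) with hF
  have hsum : HasSum (fun n => ∫ t in (0 : ℝ)..(2 * Real.pi), F n t)
      (∫ t in (0 : ℝ)..(2 * Real.pi), Complex.exp (-(Complex.I * k * t)) •
        D.evalAt (z + Complex.I * t) p) := by
    refine intervalIntegral.hasSum_integral_of_dominated_convergence
      (fun n _ => Real.exp (-(r * |(n : ℝ)|)) * max ‖D.j₀‖ ‖D.j₁‖ * ‖p‖) (fun n => ?_) (fun n => ?_) ?_ ?_ ?_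
    · exact Continuous.aestronglyMeasurable (by fun_prop)
    · refine Eventually.of_forall fun t _ => ?_
      have h1 : ‖Complex.exp (-(Complex.I * k * t))‖ = 1 := by simp [Complex.norm_exp]
      rw [hF, norm_smul, h1, one_mul]
      refine ((Complex.exp (n * (z + Complex.I * t)) • D.coef n).le_opNorm p).trans ?_
      refine mul_le_mul_of_nonneg_right (D.norm_exp_smul_coef_le ?_ ?_ n) (norm_nonneg p)
      · simp [r]
      · simp [r]
    · exact Eventually.of_forall fun t _ => ((summable_exp_neg_mul_abs_int hr).mul_right _).mul_right _
    · exact intervalIntegrable_const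
    · exact Eventually.of_forall fun t _ =>
        (D.hasSum_evalAt (mem_unitStrip_add_I_mul hz t) p).const_smul _
  have hint : ∀ n : ℤ, ∫ t in (0 : ℝ)..(2 * Real.pi), F n t =
      if n = k then ((2 * Real.pi : ℝ) : ℂ) • Complex.exp (k * z) • D.coef k p else 0 := by
    intro n
    have e : ∀ t : ℝ, F n t = (Complex.exp (-(Complex.I * k * t)) *
        Complex.exp (Complex.I * n * t)) • Complex.exp (n * z) • D.coef n p := fun t => by
      simp only [hF, smul_smul, ← Complex.exp_add]
      ring_nf
    simp_rw [e]
    rw [intervalIntegral.integral_smul_const, integral_exp_mul_exp]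
    split_ifs with h
    · rw [h]
    · rw [zero_smul]
  simp_rw [hint] at hsum
  have h2π : ((2 * Real.pi : ℝ) : ℂ) ≠ 0 := by
    exact_mod_cast Real.two_pi_pos.ne'
  rw [hsum.unique (hasSum_ite_eq k _), inv_smul_smul₀ h2π]

end Complete

end Banach

end SequentialCouple

end

/-! ### Fourier coefficients determine the function -/

noncomputable section

/-- A continuous `2π`-periodic function whose Fourier coefficients vanish is zero. -/
lemma Function.Periodic.eq_zero_of_integral_exp_eq_zero {F : ℝ → ℂ} (hF : Continuous F)
    (hp : Function.Periodic F (2 * Real.pi))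
    (h : ∀ k : ℤ, ∫ t in (0 : ℝ)..(2 * Real.pi), Complex.exp (-(Complex.I * k * t)) * F t = 0)
    (t : ℝ) : F t = 0 := by
  have : Fact (0 < 2 * Real.pi) := ⟨Real.two_pi_pos⟩
  let G : C(AddCircle (2 * Real.pi), ℂ) := ⟨hp.lift, continuous_quot_lift _ hF⟩
  have hG : ∀ s : ℝ, G (s : AddCircle (2 * Real.pi)) = F s := hp.lift_coe
  have hc : fourierCoeff G = 0 := by
    ext k
    rw [fourierCoeff_eq_intervalIntegral G k 0, zero_add, Pi.zero_apply]
    have : ∀ s : ℝ, fourier (-k) (s : AddCircle (2 * Real.pi)) • G s =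
        Complex.exp (-(Complex.I * k * s)) * F s := fun s => by
      rw [hG, smul_eq_mul, fourier_coe_apply]
      congr 2
      have : (Real.pi : ℂ) ≠ 0 := by exact_mod_cast Real.pi_ne_zero
      push_cast
      field_simp
    simp_rw [this, h k, smul_zero]
  have hs := has_pointwise_sum_fourier_series_of_summable
    (f := G) (by rw [hc]; exact summable_zero) (t : AddCircle (2 * Real.pi))
  simp only [hc, Pi.zero_apply, zero_smul] at hs
  rw [← hG, ← hs.unique hasSum_zero]

/-- Two `2πi`-periodic analytic functions on the strip with the same Fourier coefficients on one
vertical line coincide. -/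
lemma eqOn_unitStrip_of_integral_exp_eq {Y : Type*} [NormedAddCommGroup Y] [NormedSpace ℂ Y]
    [CompleteSpace Y] {f g : ℂ → Y} (hf : DifferentiableOn ℂ f unitStrip)
    (hg : DifferentiableOn ℂ g unitStrip)
    (pf : ∀ z ∈ unitStrip, f (z + 2 * Real.pi * Complex.I) = f z)
    (pg : ∀ z ∈ unitStrip, g (z + 2 * Real.pi * Complex.I) = g z) {z : ℂ} (hz : z ∈ unitStrip)
    (h : ∀ k : ℤ,
      ∫ t in (0 : ℝ)..(2 * Real.pi), Complex.exp (-(Complex.I * k * t)) • f (z + Complex.I * t) =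
      ∫ t in (0 : ℝ)..(2 * Real.pi), Complex.exp (-(Complex.I * k * t)) • g (z + Complex.I * t)) :
    EqOn f g unitStrip := by
  have hline : ∀ t : ℝ, z + Complex.I * t ∈ unitStrip := SequentialCouple.mem_unitStrip_add_I_mul hz
  have hlc : Continuous fun t : ℝ => z + Complex.I * t := by fun_prop
  have hfc : Continuous fun t : ℝ => f (z + Complex.I * t) :=
    hf.continuousOn.comp_continuous hlc hline
  have hgc : Continuous fun t : ℝ => g (z + Complex.I * t) :=
    hg.continuousOn.comp_continuous hlc hline
  have hshift : ∀ t : ℝ, z + Complex.I * ((t + 2 * Real.pi : ℝ) : ℂ) =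
      z + Complex.I * t + 2 * Real.pi * Complex.I := fun t => by push_cast; ring
  have heq : ∀ t : ℝ, f (z + Complex.I * t) = g (z + Complex.I * t) := by
    intro t
    -- Testing against continuous functionals reduces the claim to scalar functions.
    refine sub_eq_zero.1 (SeparatingDual.eq_zero_of_forall_dual_eq_zero (R := ℂ) fun ℓ => ?_)
    refine Function.Periodic.eq_zero_of_integral_exp_eq_zero
      (F := fun t : ℝ => ℓ (f (z + Complex.I * t) - g (z + Complex.I * t)))
      (ℓ.continuous.comp (hfc.sub hgc)) (fun s => ?_) (fun k => ?_) t
    · simp only [hshift]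
      rw [pf _ (hline s), pg _ (hline s)]
    · have he : Continuous fun s : ℝ => Complex.exp (-(Complex.I * k * s)) := by fun_prop
      have e : ∀ s : ℝ, Complex.exp (-(Complex.I * k * s)) *
          ℓ (f (z + Complex.I * s) - g (z + Complex.I * s)) =
          ℓ (Complex.exp (-(Complex.I * k * s)) • f (z + Complex.I * s) -
            Complex.exp (-(Complex.I * k * s)) • g (z + Complex.I * s)) := fun s => by
        rw [← smul_sub, map_smul, smul_eq_mul]
      simp_rw [e]
      have i1 : IntervalIntegrable (fun s : ℝ => Complex.exp (-(Complex.I * k * s)) •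
          f (z + Complex.I * s)) MeasureTheory.volume 0 (2 * Real.pi) :=
        (he.smul hfc).intervalIntegrable _ _
      have i2 : IntervalIntegrable (fun s : ℝ => Complex.exp (-(Complex.I * k * s)) •
          g (z + Complex.I * s)) MeasureTheory.volume 0 (2 * Real.pi) :=
        (he.smul hgc).intervalIntegrable _ _
      rw [ContinuousLinearMap.intervalIntegral_comp_comm ℓ (i1.sub i2),
        intervalIntegral.integral_sub i1 i2, h k, sub_self, map_zero]
  -- Equality on the vertical line extends to the connected strip by the identity theorem, since $z$
  -- is an accumulation point of that line.
  refine (hf.analyticOnNhd isOpen_unitStrip).eqOn_of_preconnected_of_frequently_eq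
    (hg.analyticOnNhd isOpen_unitStrip) convex_unitStrip.isPreconnected hz ?_
  have ht : Tendsto (fun t : ℝ => z + Complex.I * t) (𝓝[≠] 0) (𝓝[≠] z) := by
    refine tendsto_nhdsWithin_iff.2 ⟨?_, ?_⟩
    · have := (hlc.tendsto 0).mono_left (nhdsWithin_le_nhds (s := {0}ᶜ))
      simpa using this
    · filter_upwards [self_mem_nhdsWithin] with t ht
      simpa using ht
  exact ht.frequently (Eventually.of_forall heq).frequently

/-! ### Quotient norms of evaluation and minimal lifts -/

namespace SequentialCouple

section Banach

variable {X₀ X₁ Y E₀ E₁ : Type*}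
  [NormedAddCommGroup X₀] [NormedSpace ℂ X₀] [NormedAddCommGroup X₁] [NormedSpace ℂ X₁]
  [NormedAddCommGroup Y] [NormedSpace ℂ Y] [CompleteSpace Y]
  [NormedAddCommGroup E₀] [NormedSpace ℂ E₀] [NormedAddCommGroup E₁] [NormedSpace ℂ E₁]
  (D : SequentialCouple X₀ X₁ Y E₀ E₁)

/-- The quotient norm of `x` for evaluation at `z` on the Hardy space, equal to `∞` when `x` is
not a value. -/
def fiberNorm (z : ℂ) (x : Y) : ℝ≥0∞ :=
  ⨅ (p : D.HardySpace) (_ : D.evalAt z p = x), ‖p‖ₑ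

lemma fiberNorm_evalAt_le (z : ℂ) (p : D.HardySpace) : D.fiberNorm z (D.evalAt z p) ≤ ‖p‖ₑ :=
  biInf_le (fun p => ‖p‖ₑ) rfl

/-- Sequences of finite norm at $z$ are the sequences $e^{kz}x_k$ of Hardy space elements, and their
sum is the value at $z$. -/
lemma iInf_pairNorm_eq_fiberNorm {z : ℂ} (hz : z ∈ unitStrip) (x : Y) :
    ⨅ (s : ℤ → Y) (_ : HasSum s x), D.pairNorm z s = D.fiberNorm z x := by
  refine le_antisymm (le_iInf₂ fun p hp => ?_) (le_iInf₂ fun s hs => ?_)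
  · rw [← D.pairNorm_eq_enorm z p]
    exact iInf₂_le (fun k : ℤ => Complex.exp (k * z) • D.coef k p) (hp ▸ D.hasSum_evalAt hz p)
  · by_cases h : D.pairNorm z s < ⊤
    · obtain ⟨p, rfl⟩ := D.exists_eq_of_pairNorm_lt_top h
      rw [pairNorm_eq_enorm]
      exact iInf₂_le p ((D.hasSum_evalAt hz p).unique hs)
    · exact le_top.trans (not_lt.1 h)

lemma enorm_le_of_enorm_eq_fiberNorm {z : ℂ} {x : Y} {p : D.HardySpace}
    (h : ‖p‖ₑ = D.fiberNorm z x) : ∀ q ∈ {q | D.evalAt z q = x}, ‖p‖ ≤ ‖q‖ := fun q hq => by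
  rw [← toReal_enorm, ← toReal_enorm, h]
  exact ENNReal.toReal_mono enorm_ne_top (iInf₂_le q hq)

lemma convex_setOf_evalAt_eq (z : ℂ) (x : Y) : Convex ℝ {p | D.evalAt z p = x} := by
  intro p hp q hq a b _ _ hab
  simp only [mem_ofPred_eq] at hp hq ⊢
  rw [map_add, ← Complex.coe_smul, ← Complex.coe_smul, map_smul, map_smul, hp, hq, ← add_smul,
    ← Complex.ofReal_add, hab, Complex.ofReal_one, one_smul]

lemma exists_enorm_eq_fiberNorm [CompleteSpace E₀] [CompleteSpace E₁] [UniformConvexSpace E₀]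
    [UniformConvexSpace E₁] {z : ℂ} {x : Y} (h : D.fiberNorm z x < ⊤) :
    ∃ p : D.HardySpace, D.evalAt z p = x ∧ ‖p‖ₑ = D.fiberNorm z x := by
  have hne : {p | D.evalAt z p = x}.Nonempty := by
    simp only [fiberNorm, iInf_lt_iff] at h
    obtain ⟨p, hp, -⟩ := h
    exact ⟨p, hp⟩
  obtain ⟨p, hp, hmin⟩ := UniformConvexSpace.exists_norm_le_of_isClosed_of_convex hne
    (isClosed_eq (D.evalAt z).continuous continuous_const) (D.convex_setOf_evalAt_eq z x)
  refine ⟨p, hp, le_antisymm (le_iInf₂ fun q hq => ?_) (iInf₂_le p hp)⟩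
  rw [← ofReal_norm, ← ofReal_norm]
  exact ENNReal.ofReal_le_ofReal (hmin q hq)

lemma eq_of_enorm_eq_fiberNorm [UniformConvexSpace E₀] [UniformConvexSpace E₁] {z : ℂ} {x : Y}
    {p q : D.HardySpace} (hp : D.evalAt z p = x) (hq : D.evalAt z q = x)
    (hpn : ‖p‖ₑ = D.fiberNorm z x) (hqn : ‖q‖ₑ = D.fiberNorm z x) : p = q :=
  eq_of_minimal_norm_of_convex (D.convex_setOf_evalAt_eq z x) hp hq
    (D.enorm_le_of_enorm_eq_fiberNorm hpn) (D.enorm_le_of_enorm_eq_fiberNorm hqn)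

/-- Elements of minimal norm over nearby points of the unit sphere are close. -/
lemma enorm_sub_le_rotundityModulus [CompleteSpace E₀] [CompleteSpace E₁] [UniformConvexSpace E₀]
    [UniformConvexSpace E₁] {z : ℂ} {p q : D.HardySpace} {ε : ℝ≥0} (hp : ‖p‖ₑ = 1)
    (hq : ‖q‖ₑ = 1) (hz : D.fiberNorm z (D.evalAt z p) = 1)
    (hε : D.fiberNorm z (D.evalAt z p - D.evalAt z q) ≤ ε) :
    ‖p - q‖ₑ ≤ rotundityModulus D.HardySpace ε := by
  obtain ⟨r, hr, hrn⟩ := D.exists_enorm_eq_fiberNorm (hε.trans_lt ENNReal.coe_lt_top)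
  rw [← hrn, enorm_le_coe, ← NNReal.coe_le_coe, coe_nnnorm] at hε
  rw [enorm_eq_nnnorm, ENNReal.coe_eq_one, ← NNReal.coe_eq_one, coe_nnnorm] at hp hq
  rw [enorm_le_coe]
  refine nnnorm_sub_le_rotundityModulus hp hq ?_
  -- Because `r` lies over the difference of the values, this vector lies over the value of `p`,
  -- whose quotient norm is 1; hence $\|p+q\|+\|r\|\ge2$.
  have he : D.evalAt z ((2 : ℂ)⁻¹ • (p + q + r)) = D.evalAt z p := by
    rw [map_smul, map_add, map_add, hr, inv_smul_eq_iff₀ two_ne_zero, two_smul]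
    abel
  have h1 := D.fiberNorm_evalAt_le z ((2 : ℂ)⁻¹ • (p + q + r))
  rw [he, hz, ← ofReal_norm, ENNReal.one_le_ofReal, norm_smul, norm_inv, Complex.norm_ofNat] at h1
  linarith [norm_add_le (p + q) r]

lemma exists_eqOn_evalAt_of_pairNorm_lt_top {f : ℂ → Y} (hf : DifferentiableOn ℂ f unitStrip)
    (pf : ∀ z ∈ unitStrip, f (z + 2 * Real.pi * Complex.I) = f z) {z : ℂ} (hz : z ∈ unitStrip)
    (h : D.pairNorm z (fun k : ℤ => ((2 * Real.pi : ℝ) : ℂ)⁻¹ • ∫ t in (0 : ℝ)..(2 * Real.pi),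
      Complex.exp (-(Complex.I * k * t)) • f (z + Complex.I * t)) < ⊤) :
    ∃ p : D.HardySpace, EqOn f (fun w => D.evalAt w p) unitStrip := by
  obtain ⟨p, hp⟩ := D.exists_eq_of_pairNorm_lt_top h
  refine ⟨p, eqOn_unitStrip_of_integral_exp_eq hf (D.differentiableOn_evalAt_apply p) pf
    (fun w _ => by rw [evalAt_add_two_pi_I]) hz fun k => ?_⟩
  have h2π : ((2 * Real.pi : ℝ) : ℂ)⁻¹ ≠ 0 := inv_ne_zero (by exact_mod_cast Real.two_pi_pos.ne')
  exact smul_right_injective Y h2π ((congrFun hp k).trans (D.fourierCoef_evalAt hz p k).symm)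

lemma pairNorm_eq_enorm_of_eqOn {f : ℂ → Y} {p : D.HardySpace}
    (hfp : EqOn f (fun w => D.evalAt w p) unitStrip) {z : ℂ} (hz : z ∈ unitStrip) :
    D.pairNorm z (fun k : ℤ => ((2 * Real.pi : ℝ) : ℂ)⁻¹ • ∫ t in (0 : ℝ)..(2 * Real.pi),
      Complex.exp (-(Complex.I * k * t)) • f (z + Complex.I * t)) = ‖p‖ₑ := by
  rw [← D.pairNorm_eq_enorm z p]
  congr 1
  ext1 k
  rw [← D.fourierCoef_evalAt hz p k]
  simp_rw [hfp (mem_unitStrip_add_I_mul hz _)]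

end Banach

end SequentialCouple
end

/-! ### Optimal functions and the maps $U_{z,w}$ -/

noncomputable section

namespace SequentialCouple

/-- A couple of spaces embedded in the Banach space `Y`. -/
abbrev InBanach (X₀ X₁ Y E₀ E₁ : Type*)
    [NormedAddCommGroup X₀] [NormedSpace ℂ X₀] [NormedAddCommGroup X₁] [NormedSpace ℂ X₁]
    [NormedAddCommGroup Y] [NormedSpace ℂ Y]
    [NormedAddCommGroup E₀] [NormedSpace ℂ E₀] [NormedAddCommGroup E₁] [NormedSpace ℂ E₁] :=
  SequentialCouple X₀ X₁ Y E₀ E₁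

variable {X₀ X₁ V E₀ E₁ : Type*}
  [NormedAddCommGroup X₀] [NormedSpace ℂ X₀] [NormedAddCommGroup X₁] [NormedSpace ℂ X₁]
  [AddCommGroup V] [Module ℂ V] [TopologicalSpace V] [IsTopologicalAddGroup V]
  [ContinuousSMul ℂ V] [T2Space V]
  [NormedAddCommGroup E₀] [NormedSpace ℂ E₀] [NormedAddCommGroup E₁] [NormedSpace ℂ E₁]
  (C : SequentialCouple X₀ X₁ V E₀ E₁)

lemma ι₀_injective : Function.Injective C.ι₀ := by
  refine (injective_iff_map_eq_zero _).2 fun x hx => ?_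
  have h := (Submodule.Quotient.mk_eq_zero C.addKer).1 hx
  have h' : C.j₀ x + C.j₁ 0 = 0 := h
  rw [map_zero, add_zero] at h'
  exact C.j₀_injective (h'.trans (map_zero _).symm)

lemma ι₁_injective : Function.Injective C.ι₁ := by
  refine (injective_iff_map_eq_zero _).2 fun x hx => ?_
  have h := (Submodule.Quotient.mk_eq_zero C.addKer).1 hx
  have h' : C.j₀ 0 + C.j₁ x = 0 := h
  rw [map_zero, zero_add] at h'
  exact C.j₁_injective (h'.trans (map_zero _).symm)

lemma norm_ι₀_le (x : X₀) : ‖C.ι₀ x‖ ≤ ‖x‖ := by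
  refine (Submodule.Quotient.norm_mk_le C.addKer _).trans_eq ?_
  simp

lemma norm_ι₁_le (x : X₁) : ‖C.ι₁ x‖ ≤ ‖x‖ := by
  refine (Submodule.Quotient.norm_mk_le C.addKer _).trans_eq ?_
  simp

/-- The couple, regarded as embedded in its sum. -/
def toSum : InBanach X₀ X₁ C.Sum E₀ E₁ where
  j₀ := C.ι₀.mkContinuous 1 fun x => by rw [one_mul]; exact C.norm_ι₀_le x
  j₁ := C.ι₁.mkContinuous 1 fun x => by rw [one_mul]; exact C.norm_ι₁_le x
  j₀_injective := C.ι₀_injective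
  j₁_injective := C.ι₁_injective
  S₀ := C.S₀
  S₁ := C.S₁

lemma half_mem_unitStrip : (1 / 2 : ℂ) ∈ unitStrip := by
  norm_num [unitStrip]

variable [CompleteSpace X₀] [CompleteSpace X₁]

lemma interpNorm_eq_fiberNorm {z : ℂ} (hz : z ∈ unitStrip) (x : C.Sum) :
    C.interpNorm z x = C.toSum.fiberNorm z x :=
  C.toSum.iInf_pairNorm_eq_fiberNorm hz x

/-- Fourier coefficients on the line through $1/2$ identify $\mathcal{H}^2_\pi$, up to values off
the strip, with the Hardy space; optimality becomes minimality of the norm in a fibre. -/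
lemma isOptimal_iff {z : ℂ} (hz : z ∈ unitStrip) {x : C.Sum} {f : ℂ → C.Sum} :
    C.IsOptimal z x f ↔ ∃ p : C.toSum.HardySpace,
      EqOn f (fun w => C.toSum.evalAt w p) unitStrip ∧ C.toSum.evalAt z p = x ∧
        ‖p‖ₑ = C.toSum.fiberNorm z x := by
  constructor
  · intro h
    obtain ⟨p, hp⟩ := C.toSum.exists_eqOn_evalAt_of_pairNorm_lt_top h.mem.analytic
      h.mem.periodic half_mem_unitStrip h.mem.finite
    refine ⟨p, hp, (hp hz).symm.trans h.eval, ?_⟩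
    rw [← C.interpNorm_eq_fiberNorm hz, ← h.norm_eq]
    exact (C.toSum.pairNorm_eq_enorm_of_eqOn hp half_mem_unitStrip).symm
  · rintro ⟨p, hp, hpx, hpn⟩
    have hn : C.hardyNorm f = ‖p‖ₑ := C.toSum.pairNorm_eq_enorm_of_eqOn hp half_mem_unitStrip
    refine ⟨⟨(C.toSum.differentiableOn_evalAt_apply p).congr hp, fun w hw => ?_, ?_⟩,
      (hp hz).trans hpx, ?_⟩
    · have hw' : w + 2 * Real.pi * Complex.I ∈ unitStrip := by
        simpa [unitStrip] using hw
      rw [hp hw, hp hw']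
      simp only [evalAt_add_two_pi_I]
    · rw [hn]
      exact enorm_lt_top
    · rw [hn, hpn, C.interpNorm_eq_fiberNorm hz]

variable [CompleteSpace E₀] [CompleteSpace E₁] [UniformConvexSpace E₀] [UniformConvexSpace E₁]

lemma exists_isOptimal {z : ℂ} (hz : z ∈ unitStrip) {x : C.Sum} (hx : C.interpNorm z x < ⊤) :
    ∃ f, C.IsOptimal z x f := by
  rw [C.interpNorm_eq_fiberNorm hz] at hx
  obtain ⟨p, hp, hpn⟩ := C.toSum.exists_enorm_eq_fiberNorm hx
  exact ⟨_, (C.isOptimal_iff hz).2 ⟨p, fun _ _ => rfl, hp, hpn⟩⟩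

lemma IsOptimal.eqOn {z : ℂ} (hz : z ∈ unitStrip) {x : C.Sum} {f g : ℂ → C.Sum}
    (hf : C.IsOptimal z x f) (hg : C.IsOptimal z x g) : EqOn f g unitStrip := by
  obtain ⟨p, hp, hpx, hpn⟩ := (C.isOptimal_iff hz).1 hf
  obtain ⟨q, hq, hqx, hqn⟩ := (C.isOptimal_iff hz).1 hg
  rw [C.toSum.eq_of_enorm_eq_fiberNorm hpx hqx hpn hqn] at hp
  exact hp.trans hq.symm

/-- The optimal function is the evaluation of an element of the Hardy space of minimal norm. -/
lemma exists_transfer_eq {z : ℂ} (hz : z ∈ unitStrip) {x : C.Sum} (hx : C.interpNorm z x < ⊤) :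
    ∃ p : C.toSum.HardySpace, (∀ w ∈ unitStrip, C.transfer z w x = C.toSum.evalAt w p) ∧
      C.toSum.evalAt z p = x ∧ ‖p‖ₑ = C.interpNorm z x := by
  obtain ⟨p, hp, hpx, hpn⟩ := (C.isOptimal_iff hz).1
    (Classical.epsilon_spec (C.exists_isOptimal hz hx))
  exact ⟨p, fun w hw => hp hw, hpx, hpn.trans (C.interpNorm_eq_fiberNorm hz x).symm⟩

lemma interpNorm_transfer_lt_top {z w : ℂ} (hz : z ∈ unitStrip) (hw : w ∈ unitStrip) {x : C.Sum}
    (hx : C.interpNorm z x < ⊤) : C.interpNorm w (C.transfer z w x) < ⊤ := by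
  obtain ⟨p, hp, -, -⟩ := C.exists_transfer_eq hz hx
  rw [hp w hw, C.interpNorm_eq_fiberNorm hw]
  exact (C.toSum.fiberNorm_evalAt_le w p).trans_lt enorm_lt_top

/-- Minimal lifts live in one space for all $z$, and evaluation at $w$ contracts their difference;
hence the bound involves neither point. -/
lemma transferModulus_le {z w : ℂ} (hz : z ∈ unitStrip) (hw : w ∈ unitStrip) (ε : ℝ≥0) :
    C.transferModulus z w ε ≤ rotundityModulus C.toSum.HardySpace ε := by
  refine iSup₂_le fun x hx => iSup₂_le fun y hy => iSup_le fun hxy => ?_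
  have hx1 : C.interpNorm z x = 1 := hx
  have hy1 : C.interpNorm z y = 1 := hy
  obtain ⟨p, hp, hpx, hpn⟩ := C.exists_transfer_eq hz (hx1.trans_lt ENNReal.one_lt_top)
  obtain ⟨q, hq, hqy, hqn⟩ := C.exists_transfer_eq hz (hy1.trans_lt ENNReal.one_lt_top)
  rw [hp w hw, hq w hw, C.interpNorm_eq_fiberNorm hw]
  have hle := C.toSum.fiberNorm_evalAt_le w (p - q)
  rw [map_sub] at hle
  refine hle.trans (C.toSum.enorm_sub_le_rotundityModulus (z := z) (hpn.trans hx1)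
    (hqn.trans hy1) ?_ ?_)
  · rw [hpx, ← C.interpNorm_eq_fiberNorm hz, hx1]
  · rwa [hpx, hqy, ← C.interpNorm_eq_fiberNorm hz]

end SequentialCouple

end

theorem mainTheorem6 {X₀ X₁ V E₀ E₁ : Type*}
    [NormedAddCommGroup X₀] [NormedSpace ℂ X₀] [CompleteSpace X₀]
    [NormedAddCommGroup X₁] [NormedSpace ℂ X₁] [CompleteSpace X₁]
    [AddCommGroup V] [Module ℂ V] [TopologicalSpace V] [IsTopologicalAddGroup V]
    [ContinuousSMul ℂ V] [T2Space V]
    [NormedAddCommGroup E₀] [NormedSpace ℂ E₀] [CompleteSpace E₀]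
    [NormedAddCommGroup E₁] [NormedSpace ℂ E₁] [CompleteSpace E₁]
    (C : SequentialCouple X₀ X₁ V E₀ E₁) (hC : C.IsDaher) :
    -- optimal functions exist and are unique on the strip
    (∀ z ∈ unitStrip, ∀ x ∈ C.interpSphere z,
      (∃ f, C.IsOptimal z x f) ∧
        ∀ f g, C.IsOptimal z x f → C.IsOptimal z x g → EqOn f g unitStrip) ∧
    -- `U_{z,w}` takes its values in the interpolation space at `w`
    (∀ z ∈ unitStrip, ∀ w ∈ unitStrip, ∀ x ∈ C.interpSphere z,
      C.interpNorm w (C.transfer z w x) < ⊤) ∧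
    -- one function bounds all the moduli of continuity
    ∃ γ : ℝ≥0 → ℝ≥0, Tendsto γ (𝓝 0) (𝓝 0) ∧
      ∀ z ∈ unitStrip, ∀ w ∈ unitStrip, ∀ ε : ℝ≥0, C.transferModulus z w ε ≤ γ ε := by
  have := hC.uniformConvex₀
  have := hC.uniformConvex₁
  have hlt : ∀ {z : ℂ} {x : C.Sum}, x ∈ C.interpSphere z → C.interpNorm z x < ⊤ := fun hx =>
    (show _ = _ from hx).trans_lt ENNReal.one_lt_top
  exact ⟨fun z hz x hx => ⟨C.exists_isOptimal hz (hlt hx), fun f g hf hg =>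
      SequentialCouple.IsOptimal.eqOn C hz hf hg⟩,
    fun z hz w hw x hx => C.interpNorm_transfer_lt_top hz hw (hlt hx),
    rotundityModulus C.toSum.HardySpace, tendsto_rotundityModulus,
    fun z hz w hw ε => C.transferModulus_le hz hw ε⟩
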